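/- All graphs are finite and simple. For a graph $G$ let $\alpha(G)$ be its independence number and $G^{\boxtimes n}$ its $n$-fold strong power: the vertices are the $n$-tuples of vertices of $G$, and two distinct tuples are adjacent iff in every coordinate their entries are equal or adjacent. The Shannon capacity of $G$ is $\mathscr C(G)=\lim_{n\to\infty}\alpha(G^{\boxtimes n})^{1/n}$. The Haemers number $\mathcal H(G)$ is the minimum, over all fields $K$, of the rank of a matrix $B\in K^{V(G)\times V(G)}$ with $B_{vv}\neq 0$ for all $v$ and $B_{uv}=0$ for all distinct nonadjacent $u,v$. Let $$\Gamma_0(G,H)=\min_f\max_{v\in V(G)}\frac1{|f(v)|}\in[0,\infty]\qquad(1/0=\infty),$$ where $f$ ranges over all maps assigning to each vertex of $G$ an independent set of $H$ (possibly empty) such that for distinct nonadjacent vertices $v_1,v_2$ of $G$ the sets $f(v_1),f(v_2)$ are disjoint and $f(v_1)\cup f(v_2)$ is independent in $H$. Let $C_m$ be the cycle of length $m$, and let $J(n,3)$ be the graph whose vertices are the $3$-subsets of $\{1,\dots,n\}$, two being adjacent iff they meet in exactly one element. Then: 1. For every integer $k\ge 1$, $\Gamma_0(C_{2k+1},J(4k+2,3))=\tfrac14$,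 and $$4\,\mathscr C(C_{2k+1})\le \mathscr C(J(4k+2,3))\le \mathcal H(J(4k+2,3)),\qquad \mathcal H(J(4k+2,3))\ge\lceil 4\,\mathscr C(C_{2k+1})\rceil .$$ 2. $\mathscr C(J(14,3))\ge 4\cdot 3.2578$, $\mathscr C(J(18,3))\ge 4\cdot 4.32$, $\mathscr C(J(22,3))\ge 4\cdot 5.2895$, $\mathscr C(J(26,3))\ge 4\cdot 6.2743$, and $\mathcal H(J(n,3))=n$ for $n=14,18,22,26$. 3. $\displaystyle\lim_{n\to\infty}\bigl(4n+2-\mathscr C(J(4n+2,3))\bigr)=0.$ -/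

import Mathlib

open Filter Topology
open scoped ENNReal

/-- The `n`-fold strong product of `G` with itself: two distinct `n`-tuples are adjacent iff in
every coordinate their entries are equal or adjacent. -/
def strongPow {V : Type*} (G : SimpleGraph V) (n : ℕ) : SimpleGraph (Fin n → V) where
  Adj x y := x ≠ y ∧ ∀ i, x i = y i ∨ G.Adj (x i) (y i)
  symm := ⟨fun _ _ h => ⟨h.1.symm, fun i => (h.2 i).imp Eq.symm fun a => a.symm⟩⟩
  loopless := ⟨fun _ h => h.1 rfl⟩

/-- The Shannon capacity `lim α(G^{⊠ n})^{1/n}`. The limit exists for every finite graph, see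
`tendsto_shannonCapacity`. -/
noncomputable def shannonCapacity {V : Type*} (G : SimpleGraph V) : ℝ :=
  limUnder atTop fun n : ℕ => ((strongPow G n).indepNum : ℝ) ^ (1 / (n : ℝ))

/-- The Haemers number: the least rank, over all fields, of a matrix with nonzero diagonal entries
and with zero entries at all pairs of distinct nonadjacent vertices. (For a finite graph the
entries of a matrix generate a countable subfield, so fields in `Type` suffice.) -/
noncomputable def haemersNumber {V : Type*} [Fintype V] (G : SimpleGraph V) : ℕ :=
  sInf {r | ∃ (K : Type) (_ : Field K) (B : Matrix V V K),
    (∀ v, B v v ≠ 0) ∧ (∀ u v, u ≠ v → ¬ G.Adj u v → B u v = 0) ∧ B.rank = r}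

/-- The graph `J(n,3)`: the vertices are the `3`-subsets of an `n`-set, adjacent iff they meet in
exactly one element. -/
def johnsonThree (n : ℕ) : SimpleGraph {s : Finset (Fin n) // s.card = 3} where
  Adj s t := (s.1 ∩ t.1).card = 1
  symm := ⟨fun s t h => by rw [Finset.inter_comm]; exact h⟩
  loopless := ⟨fun s h => by
    have := s.2
    rw [Finset.inter_self] at h
    omega⟩

/-- Two independent sets are disconnected if they are disjoint and their union is independent. -/
def DisconnectedSets {W : Type*} (H : SimpleGraph W) (S T : Finset W) : Prop :=
  Disjoint S T ∧ H.IsIndepSet ((S : Set W) ∪ (T : Set W))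

/-- The set `𝓕(H, G)` of assignments of independent sets of `H` to the vertices of `G` such that
distinct nonadjacent vertices of `G` receive disconnected sets. -/
def assignments {W V : Type*} (H : SimpleGraph W) (G : SimpleGraph V) : Set (V → Finset W) :=
  {f | (∀ v, H.IsIndepSet (f v : Set W)) ∧
    ∀ v₁ v₂, v₁ ≠ v₂ → ¬ G.Adj v₁ v₂ → DisconnectedSets H (f v₁) (f v₂)}

/-- `Γ₀(G, H) = min_f max_v 1 / |f v|` over `f ∈ 𝓕(H, G)`, with `1 / 0 = ∞`. For finite graphs the
infimum and the supremum range over finite sets. -/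
noncomputable def gammaZero {V W : Type*} (G : SimpleGraph V) (H : SimpleGraph W) : ℝ≥0∞ :=
  ⨅ f ∈ assignments H G, ⨆ v, 1 / ((f v).card : ℝ≥0∞)

/-- The independence number is supermultiplicative along strong powers. -/
theorem indepNum_strongPow_mul_le {V : Type*} [Finite V] (G : SimpleGraph V) (m n : ℕ) :
    (strongPow G m).indepNum * (strongPow G n).indepNum ≤ (strongPow G (m + n)).indepNum := by
  classical
  have := Fintype.ofFinite V
  obtain ⟨s, hs⟩ := (strongPow G m).exists_isNIndepSet_indepNum
  obtain ⟨t, ht⟩ := (strongPow G n).exists_isNIndepSet_indepNum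
  let e : (Fin m → V) × (Fin n → V) ≃ (Fin (m + n) → V) := Fin.appendEquiv m n
  rw [← hs.card_eq, ← ht.card_eq, ← Finset.card_product, ← Finset.card_map e.toEmbedding]
  refine SimpleGraph.IsIndepSet.card_le_indepNum ?_
  intro x hx y hy hxy hadj
  simp only [Finset.coe_map, Set.mem_image, Finset.mem_coe, Finset.mem_product] at hx hy
  obtain ⟨⟨a, b⟩, ⟨ha, hb⟩, rfl⟩ := hx
  obtain ⟨⟨c, d⟩, ⟨hc, hd⟩, rfl⟩ := hy
  have h1 : ∀ i, a i = c i ∨ G.Adj (a i) (c i) := fun i => by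
    simpa [e, Fin.appendEquiv] using hadj.2 (Fin.castAdd n i)
  have h2 : ∀ i, b i = d i ∨ G.Adj (b i) (d i) := fun i => by
    simpa [e, Fin.appendEquiv] using hadj.2 (Fin.natAdd m i)
  have hac : a = c := by
    by_contra hne
    exact hs.isIndepSet ha hc hne ⟨hne, h1⟩
  have hbd : b = d := by
    by_contra hne
    exact ht.isIndepSet hb hd hne ⟨hne, h2⟩
  exact hxy (by rw [hac, hbd])

/-- The limit that defines the Shannon capacity of a finite graph exists. -/
theorem tendsto_shannonCapacity {V : Type*} [Finite V] (G : SimpleGraph V) :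
    Tendsto (fun n : ℕ => ((strongPow G n).indepNum : ℝ) ^ (1 / (n : ℝ))) atTop
      (𝓝 (shannonCapacity G)) := by
  classical
  have := Fintype.ofFinite V
  refine tendsto_nhds_limUnder ?_
  rcases isEmpty_or_nonempty V with hV | hV
  · refine ⟨0, tendsto_const_nhds.congr' ?_⟩
    filter_upwards [eventually_ge_atTop 1] with n hn
    obtain ⟨s, hs⟩ := (strongPow G n).exists_isNIndepSet_indepNum
    have : IsEmpty (Fin n → V) := ⟨fun f => hV.elim (f ⟨0, hn⟩)⟩
    have hs0 : s = ∅ := Finset.eq_empty_of_isEmpty s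
    rw [← hs.card_eq, hs0]
    have hn' : (1 / (n : ℝ)) ≠ 0 := by positivity
    simp only [Finset.card_empty, Nat.cast_zero]
    rw [Real.zero_rpow hn']
  · have hpos : ∀ n, 1 ≤ (strongPow G n).indepNum := fun n => by
      have x : Fin n → V := fun _ => Classical.arbitrary V
      have h := SimpleGraph.IsIndepSet.card_le_indepNum (G := strongPow G n) (t := {x})
        (by simp [SimpleGraph.IsIndepSet])
      simpa using h
    have hposR : ∀ n, (0 : ℝ) < ((strongPow G n).indepNum : ℝ) := fun n => by
      exact_mod_cast hpos n
    have hle : ∀ n, (strongPow G n).indepNum ≤ Fintype.card V ^ n := fun n => by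
      obtain ⟨s, hs⟩ := (strongPow G n).exists_isNIndepSet_indepNum
      rw [← hs.card_eq]
      simpa using s.card_le_univ
    let u : ℕ → ℝ := fun n => -Real.log ((strongPow G n).indepNum : ℝ)
    have hu : Subadditive u := fun m n => by
      have h : ((strongPow G m).indepNum : ℝ) * ((strongPow G n).indepNum : ℝ)
          ≤ ((strongPow G (m + n)).indepNum : ℝ) := by
        exact_mod_cast indepNum_strongPow_mul_le G m n
      have h' := Real.log_le_log (mul_pos (hposR m) (hposR n)) h
      rw [Real.log_mul (hposR m).ne' (hposR n).ne'] at h'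
      simp only [u]
      linarith
    have hbdd : BddBelow (Set.range fun n => u n / n) := by
      refine ⟨-Real.log (Fintype.card V), ?_⟩
      rintro _ ⟨n, rfl⟩
      have hlog : 0 ≤ Real.log (Fintype.card V : ℝ) :=
        Real.log_natCast_nonneg _
      rcases Nat.eq_zero_or_pos n with rfl | hn
      · simpa using hlog
      have hn' : (0 : ℝ) < n := by exact_mod_cast hn
      have h : Real.log ((strongPow G n).indepNum : ℝ) ≤ n * Real.log (Fintype.card V) := by
        rw [← Real.log_pow]
        exact Real.log_le_log (hposR n) (by exact_mod_cast hle n)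
      simp only [u]
      rw [le_div_iff₀ hn']
      linarith
    refine ⟨Real.exp (-hu.lim), ?_⟩
    refine ((Real.continuous_exp.tendsto _).comp (hu.tendsto_lim hbdd).neg).congr fun n => ?_
    rw [Real.rpow_def_of_pos (hposR n)]
    simp only [Function.comp_apply, u]
    congr 1
    ring

/-! Everything is squeezed between two bounds on independent sets in strong powers of the triple
graph. From above, the Gram matrix over 𝔽₂ has rank at most the number of points, and tensor powers
of a matrix turn its rank into a bound for every power (`indepNum_strongPow_le_rank_pow`). From
below, replace each vertex of an odd cycle by the four triples in a block of four points,
consecutive blocks sharing a pair; this gains a factor 4 per coordinate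
(`pow_mul_indepNum_le_of_mem_assignments`).

No assignment does better than 4 per vertex: with 5, the same product construction would break the
rank bound, except on the triangle, where independent sets of triples in six points are checked
directly. The decimal bounds come from explicit independent sets in powers of `C₇`, `C₉`, `C₁₁`,
`C₁₃`; each pushes the capacity above `n - 1`, and integrality fixes the Haemers number.

For the limit, the capacity of `C_m`, `m` odd, has to approach `m / 2`. A binary-weight construction
(`mul_pow_le_indepNum_cycleGraph`) does this for `m ≡ 1` modulo a power of 2, and folding a longer
odd cycle onto such a cycle preserves the density of independent sets
(`card_pow_mul_indepNum_le_of_hom`). -/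

section Capacity

/-! ### Transfer of independent sets between strong powers -/

variable {V W : Type*}

theorem exists_ne_not_adj_of_not_adj_strongPow {G : SimpleGraph V} {n : ℕ} {x y : Fin n → V}
    (hxy : x ≠ y) (h : ¬ (strongPow G n).Adj x y) : ∃ i, x i ≠ y i ∧ ¬ G.Adj (x i) (y i) := by
  by_contra! hc
  exact h ⟨hxy, fun i => or_iff_not_imp_left.2 (hc i)⟩

theorem isIndepSet_strongPow {G : SimpleGraph V} {n : ℕ} {S : Set (Fin n → V)}
    (h : ∀ x ∈ S, ∀ y ∈ S, (∀ i, x i = y i ∨ G.Adj (x i) (y i)) → x = y) :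
    (strongPow G n).IsIndepSet S :=
  fun x hx y hy hne hadj => hne (h x hx y hy hadj.2)

theorem indepNum_strongPow_pow_le [Finite V] (G : SimpleGraph V) (d n : ℕ) :
    (strongPow G d).indepNum ^ n ≤ (strongPow G (d * n)).indepNum := by
  induction n with
  | zero =>
    have h := SimpleGraph.IsIndepSet.card_le_indepNum (G := strongPow G (d * 0))
      (t := {fun i => i.elim0}) (by simp [SimpleGraph.IsIndepSet])
    simpa using h
  | succ n ih =>
    rw [pow_succ, mul_add, mul_one]
    exact (Nat.mul_le_mul_right _ ih).trans (indepNum_strongPow_mul_le G _ _)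

/-- Since the limit exists, it can be computed along the multiples of `d`, where products of one
good independent set are available. -/
theorem le_shannonCapacity_of_pow_le [Finite V] (G : SimpleGraph V) {d : ℕ} (hd : 0 < d) {y : ℝ}
    (hy : 0 ≤ y) (h : y ^ d ≤ (strongPow G d).indepNum) : y ≤ shannonCapacity G := by
  have ht : Tendsto (fun n : ℕ => d * n) atTop atTop := tendsto_id.const_mul_atTop' hd
  refine ge_of_tendsto ((tendsto_shannonCapacity G).comp ht) ?_
  filter_upwards [eventually_ge_atTop 1] with n hn
  have hdn : d * n ≠ 0 := by positivity
  calc y = (y ^ (d * n)) ^ (1 / ((d * n : ℕ) : ℝ)) := by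
        rw [one_div, Real.pow_rpow_inv_natCast hy hdn]
    _ ≤ _ := by
        refine Real.rpow_le_rpow (by positivity) ?_ (by positivity)
        rw [pow_mul]
        calc (y ^ d) ^ n ≤ ((strongPow G d).indepNum : ℝ) ^ n :=
              pow_le_pow_left₀ (by positivity) h n
          _ ≤ _ := by exact_mod_cast indepNum_strongPow_pow_le G d n

theorem shannonCapacity_le_of_le_pow [Finite V] (G : SimpleGraph V) {r : ℕ}
    (h : ∀ n, (strongPow G n).indepNum ≤ r ^ n) : shannonCapacity G ≤ r := by
  refine le_of_tendsto (tendsto_shannonCapacity G) ?_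
  filter_upwards [eventually_ge_atTop 1] with n hn
  calc ((strongPow G n).indepNum : ℝ) ^ (1 / (n : ℝ)) ≤ ((r : ℝ) ^ n) ^ (1 / (n : ℝ)) :=
        Real.rpow_le_rpow (by positivity) (by exact_mod_cast h n) (by positivity)
    _ = r := by rw [one_div, Real.pow_rpow_inv_natCast (by positivity) (by omega)]

theorem mul_shannonCapacity_le [Finite V] [Finite W] (G : SimpleGraph V) (H : SimpleGraph W)
    {c : ℕ} (h : ∀ n, c ^ n * (strongPow G n).indepNum ≤ (strongPow H n).indepNum) :
    c * shannonCapacity G ≤ shannonCapacity H := by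
  refine le_of_tendsto_of_tendsto ((tendsto_shannonCapacity G).const_mul (c : ℝ))
    (tendsto_shannonCapacity H) ?_
  filter_upwards [eventually_ge_atTop 1] with n hn
  calc (c : ℝ) * ((strongPow G n).indepNum : ℝ) ^ (1 / (n : ℝ))
      = ((c : ℝ) ^ n * (strongPow G n).indepNum) ^ (1 / (n : ℝ)) := by
        rw [Real.mul_rpow (by positivity) (by positivity), one_div,
          Real.pow_rpow_inv_natCast (by positivity) (by omega)]
    _ ≤ _ := Real.rpow_le_rpow (by positivity) (by exact_mod_cast h n) (by positivity)

/-- An assignment of independent sets with at least `c` elements each multiplies the independence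
number of the `n`-th strong power by at least `c ^ n`. -/
theorem pow_mul_indepNum_le_of_mem_assignments [Finite V] [Finite W] {G : SimpleGraph V}
    {H : SimpleGraph W} {f : V → Finset W} (hf : f ∈ assignments H G) {c : ℕ}
    (hc : ∀ v, c ≤ (f v).card) (n : ℕ) :
    c ^ n * (strongPow G n).indepNum ≤ (strongPow H n).indepNum := by
  classical
  have := Fintype.ofFinite V
  have := Fintype.ofFinite W
  obtain ⟨S, hS⟩ := (strongPow G n).exists_isNIndepSet_indepNum
  have sep : ∀ s ∈ S, ∀ t ∈ S, s ≠ t → ∃ i, DisconnectedSets H (f (s i)) (f (t i)) := by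
    intro s hs t ht hst
    obtain ⟨i, hi, hi'⟩ := exists_ne_not_adj_of_not_adj_strongPow hst (hS.isIndepSet hs ht hst)
    exact ⟨i, hf.2 _ _ hi hi'⟩
  -- One box of words over `H` per word of `S`. Distinct words of `S` have a coordinate with
  -- distinct nonadjacent entries, and there the two boxes are disconnected.
  let T : Finset (Fin n → W) := S.biUnion fun s => Fintype.piFinset fun i => f (s i)
  have hcard : T.card = ∑ s ∈ S, ∏ i, (f (s i)).card := by
    rw [Finset.card_biUnion]
    · simp
    · intro s hs t ht hst
      obtain ⟨i, hi⟩ := sep s hs t ht hst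
      refine Finset.disjoint_left.2 fun y hy hy' => ?_
      rw [Fintype.mem_piFinset] at hy hy'
      exact Finset.disjoint_left.1 hi.1 (hy i) (hy' i)
  have hind : (strongPow H n).IsIndepSet T := by
    refine isIndepSet_strongPow fun y hy z hz hyz => ?_
    simp only [T, Finset.coe_biUnion, Set.mem_iUnion, Finset.mem_coe, Fintype.mem_piFinset] at hy hz
    obtain ⟨s, hs, hys⟩ := hy
    obtain ⟨t, ht, hzt⟩ := hz
    by_cases hst : s = t
    · subst hst
      funext i
      by_contra hne
      exact hf.1 (s i) (hys i) (hzt i) hne ((hyz i).resolve_left hne)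
    · obtain ⟨i, hd, hi⟩ := sep s hs t ht hst
      have hne : y i ≠ z i := fun h => Finset.disjoint_left.1 hd (hys i) (h ▸ hzt i)
      exact absurd ((hyz i).resolve_left hne) (hi (Or.inl (hys i)) (Or.inr (hzt i)) hne)
  calc c ^ n * (strongPow G n).indepNum = ∑ s ∈ S, ∏ _i : Fin n, c := by
        simp [hS.card_eq, mul_comm]
    _ ≤ ∑ s ∈ S, ∏ i, (f (s i)).card :=
        Finset.sum_le_sum fun s _ => Finset.prod_le_prod' fun i _ => hc (s i)
    _ = T.card := hcard.symm
    _ ≤ _ := hind.card_le_indepNum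

/-- A homomorphism into a graph whose adjacency is invariant under the translations of a group
does not decrease the density of independent sets in strong powers. -/
theorem card_pow_mul_indepNum_le_of_hom {A : Type*} [Fintype V] [AddGroup A] [Fintype A]
    {G : SimpleGraph V} {H : SimpleGraph A}
    (htrans : ∀ a u v, H.Adj u v → H.Adj (a + u) (a + v)) (φ : G →g H) (n : ℕ) :
    Fintype.card V ^ n * (strongPow H n).indepNum ≤
      Fintype.card A ^ n * (strongPow G n).indepNum := by
  classical
  obtain ⟨S, hS⟩ := (strongPow H n).exists_isNIndepSet_indepNum
  -- Double counting: each `x` is hit by exactly `S.card` translations, while each `t` pulls `S`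
  -- back to an independent set.
  let R : (Fin n → A) → (Fin n → V) → Prop := fun t x => (fun i => t i + φ (x i)) ∈ S
  have hrow : ∀ t, (Finset.univ.bipartiteAbove R t).card ≤ (strongPow G n).indepNum := by
    intro t
    refine SimpleGraph.IsIndepSet.card_le_indepNum (isIndepSet_strongPow fun x hx y hy hxy => ?_)
    simp only [Finset.mem_coe, Finset.mem_bipartiteAbove, Finset.mem_univ, true_and, R] at hx hy
    by_contra hne
    obtain ⟨i, hi⟩ := Function.ne_iff.1 hne
    -- `φ` need not be injective: adjacent vertices have adjacent, hence distinct, images, so `x`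
    -- and `y` are not merged.
    have hadj := φ.map_adj ((hxy i).resolve_left hi)
    have hne' : (fun i => t i + φ (x i)) ≠ fun i => t i + φ (y i) := fun h =>
      hadj.ne (add_left_cancel (congrFun h i))
    obtain ⟨j, hj, hj'⟩ := exists_ne_not_adj_of_not_adj_strongPow hne' (hS.isIndepSet hx hy hne')
    rcases hxy j with h | h
    · exact hj (by rw [h])
    · exact hj' (htrans _ _ _ (φ.map_adj h))
  have hcol : ∀ x, (Finset.univ.bipartiteBelow R x).card = S.card := by
    intro x
    refine Finset.card_bij (fun t _ i => t i + φ (x i)) ?_ ?_ ?_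
    · intro t ht
      simpa [R] using ht
    · intro t _ t' _ h
      funext i
      exact add_right_cancel (congrFun h i)
    · intro s hs
      exact ⟨fun i => s i - φ (x i), by simpa [R] using hs, by simp⟩
  have hdouble := Finset.sum_card_bipartiteAbove_eq_sum_card_bipartiteBelow
    (s := (Finset.univ : Finset (Fin n → A))) (t := (Finset.univ : Finset (Fin n → V))) R
  calc Fintype.card V ^ n * (strongPow H n).indepNum
      = ∑ x, (Finset.univ.bipartiteBelow R x).card := by simp [hcol, hS.card_eq]
    _ = ∑ t, (Finset.univ.bipartiteAbove R t).card := hdouble.symm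
    _ ≤ ∑ _t : Fin n → A, (strongPow G n).indepNum := Finset.sum_le_sum fun t _ => hrow t
    _ = _ := by simp

/-! ### The rank bound -/

/-- Every matrix over a field factors through its rank. -/
theorem Matrix.exists_eq_mul_of_rank {m n K : Type*} [Fintype n] [Finite m] [Field K]
    (B : Matrix m n K) :
    ∃ (P : Matrix m (Fin B.rank) K) (Q : Matrix (Fin B.rank) n K), B = P * Q := by
  classical
  let b := Module.finBasisOfFinrankEq K (LinearMap.range B.mulVecLin) (n := B.rank) rfl
  refine ⟨Matrix.of fun i k => (b k).1 i, Matrix.of fun k j =>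
    b.repr ⟨B.mulVecLin (Pi.single j 1), LinearMap.mem_range_self _ _⟩ k, ?_⟩
  ext i j
  have h := congrArg (fun u => u.1 i)
    (b.sum_repr ⟨B.mulVecLin (Pi.single j 1), LinearMap.mem_range_self _ _⟩)
  simp only [Submodule.coe_sum, Submodule.coe_smul, Finset.sum_apply, Pi.smul_apply, smul_eq_mul,
    Matrix.mulVecLin_apply, Matrix.mulVec_single_one, Matrix.col_apply] at h
  rw [Matrix.mul_apply, ← h]
  refine Finset.sum_congr rfl fun k _ => ?_
  simp only [Matrix.of_apply, Matrix.mulVecLin_apply, Matrix.mulVec_single_one]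
  exact mul_comm _ _

/-- Haemers' bound for strong powers. -/
theorem indepNum_strongPow_le_rank_pow [Fintype V] {G : SimpleGraph V} {K : Type*} [Field K]
    {B : Matrix V V K} (hdiag : ∀ v, B v v ≠ 0)
    (hoff : ∀ u v, u ≠ v → ¬ G.Adj u v → B u v = 0) (n : ℕ) :
    (strongPow G n).indepNum ≤ B.rank ^ n := by
  classical
  obtain ⟨P, Q, hPQ⟩ := B.exists_eq_mul_of_rank
  obtain ⟨S, hS⟩ := (strongPow G n).exists_isNIndepSet_indepNum
  -- Tensor powers of the two factors, restricted to `S`. Their product is the restricted tensor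
  -- power of `B`, which is diagonal because `B` vanishes at some coordinate of any two distinct
  -- words of `S`.
  let P' : Matrix S (Fin n → Fin B.rank) K := Matrix.of fun x f => ∏ i, P (x.1 i) (f i)
  let Q' : Matrix (Fin n → Fin B.rank) S K := Matrix.of fun f y => ∏ i, Q (f i) (y.1 i)
  have hmul : P' * Q' = Matrix.diagonal fun x : S => ∏ i, B (x.1 i) (x.1 i) := by
    ext x y
    have hprod : (P' * Q') x y = ∏ i, B (x.1 i) (y.1 i) := by
      simp only [Matrix.mul_apply, Matrix.of_apply, P', Q', ← Finset.prod_mul_distrib]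
      rw [← Fintype.prod_sum fun i k => P (x.1 i) k * Q k (y.1 i)]
      refine Finset.prod_congr rfl fun i _ => ?_
      conv_rhs => rw [hPQ]
      rw [Matrix.mul_apply]
    rw [hprod]
    by_cases hxy : x = y
    · subst hxy
      simp
    · have hne : x.1 ≠ y.1 := fun h => hxy (Subtype.ext h)
      obtain ⟨i, hi, hi'⟩ :=
        exists_ne_not_adj_of_not_adj_strongPow hne (hS.isIndepSet x.2 y.2 hne)
      rw [Matrix.diagonal_apply_ne _ hxy]
      exact Finset.prod_eq_zero (Finset.mem_univ i) (hoff _ _ hi hi')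
  have hrank : (P' * Q').rank = S.card := by
    rw [Matrix.rank_of_det_ne_zero]
    · simp
    · rw [hmul, Matrix.det_diagonal]
      exact Finset.prod_ne_zero_iff.2 fun x _ => Finset.prod_ne_zero_iff.2 fun i _ => hdiag _
  calc (strongPow G n).indepNum = (P' * Q').rank := by rw [hrank, hS.card_eq]
    _ ≤ P'.rank := Matrix.rank_mul_le_left _ _
    _ ≤ Fintype.card (Fin n → Fin B.rank) := Matrix.rank_le_card_width _
    _ = B.rank ^ n := by simp

theorem indepNum_strongPow_le_haemersNumber_pow [Fintype V] (G : SimpleGraph V) (n : ℕ) :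
    (strongPow G n).indepNum ≤ haemersNumber G ^ n := by
  classical
  -- The identity matrix is admissible, so the infimum is attained and is not the default value 0 of
  -- an empty `sInf`.
  have hne : {r | ∃ (K : Type) (_ : Field K) (B : Matrix V V K),
      (∀ v, B v v ≠ 0) ∧ (∀ u v, u ≠ v → ¬ G.Adj u v → B u v = 0) ∧ B.rank = r}.Nonempty :=
    ⟨_, ℚ, inferInstance, 1, by simp, fun u v h _ => Matrix.one_apply_ne h, rfl⟩
  obtain ⟨K, _, B, hdiag, hoff, hr⟩ := Nat.sInf_mem hne
  rw [haemersNumber, ← hr]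
  exact indepNum_strongPow_le_rank_pow hdiag hoff n

theorem shannonCapacity_le_haemersNumber [Fintype V] (G : SimpleGraph V) :
    shannonCapacity G ≤ haemersNumber G :=
  shannonCapacity_le_of_le_pow G (indepNum_strongPow_le_haemersNumber_pow G)

end Capacity

/-! ### Triples: rank bound, blocks of four points, and the six-point case -/

section Johnson

/-- The Gram matrix over `𝔽₂` of the characteristic vectors of the triples has rank at most `n`. -/
theorem haemersNumber_johnsonThree_le (n : ℕ) : haemersNumber (johnsonThree n) ≤ n := by
  classical
  let M : Matrix {s : Finset (Fin n) // s.card = 3} (Fin n) (ZMod 2) :=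
    Matrix.of fun s i => if i ∈ s.1 then 1 else 0
  have hM : ∀ s t, (M * M.transpose) s t = ((s.1 ∩ t.1).card : ZMod 2) := by
    intro s t
    simp [M, Matrix.mul_apply, ← ite_and, Finset.filter_and, Finset.inter_comm]
  have hrank : (M * M.transpose).rank ≤ n := by
    simpa using (Matrix.rank_mul_le_left M M.transpose).trans (Matrix.rank_le_card_width M)
  refine le_trans (Nat.sInf_le ⟨ZMod 2, inferInstance, M * M.transpose, fun s => ?_,
    fun s t hst hadj => ?_, rfl⟩) hrank
  · rw [hM, Finset.inter_self, s.2]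
    decide
  · rw [hM]
    have hle : (s.1 ∩ t.1).card ≤ 3 := (Finset.card_le_card Finset.inter_subset_left).trans s.2.le
    have h1 : (s.1 ∩ t.1).card ≠ 1 := hadj
    have h3 : (s.1 ∩ t.1).card ≠ 3 := fun h => by
      have hs : s.1 ∩ t.1 = s.1 := Finset.eq_of_subset_of_card_le Finset.inter_subset_left
        (by rw [h, s.2])
      have ht : s.1 ∩ t.1 = t.1 := Finset.eq_of_subset_of_card_le Finset.inter_subset_right
        (by rw [h, t.2])
      exact hst (Subtype.ext (hs.symm.trans ht))
    -- Both possible sizes are even, whereas the diagonal entry 3 is odd.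
    have : (s.1 ∩ t.1).card = 0 ∨ (s.1 ∩ t.1).card = 2 := by omega
    rcases this with h | h <;> rw [h] <;> decide

theorem indepNum_strongPow_johnsonThree_le (n d : ℕ) :
    (strongPow (johnsonThree n) d).indepNum ≤ n ^ d :=
  (indepNum_strongPow_le_haemersNumber_pow _ d).trans
    (Nat.pow_le_pow_left (haemersNumber_johnsonThree_le n) d)

theorem cycleGraph_adj_iff {m : ℕ} [NeZero m] (hm : 2 ≤ m) {u v : Fin m} :
    (SimpleGraph.cycleGraph m).Adj u v ↔ u = v + 1 ∨ v = u + 1 := by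
  obtain ⟨n, rfl⟩ : ∃ n, m = n + 2 := ⟨m - 2, by omega⟩
  rw [SimpleGraph.cycleGraph_adj, sub_eq_iff_eq_add', sub_eq_iff_eq_add', add_comm v, add_comm u]

/-- The union of the `v`-th and the `(v + 1)`-st of the pairs `{2 i, 2 i + 1}`. -/
def cycleBlock (k : ℕ) (v : Fin (2 * k + 1)) : Finset (Fin (4 * k + 2)) :=
  Finset.univ.filter fun x => x.val / 2 = v.val ∨ x.val / 2 = (v + 1).val

/-- The triples inside `cycleBlock k v`. -/
def cycleTriples (k : ℕ) (v : Fin (2 * k + 1)) :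
    Finset {s : Finset (Fin (4 * k + 2)) // s.card = 3} :=
  Finset.univ.filter fun s => s.1 ⊆ cycleBlock k v

theorem card_cycleBlock {k : ℕ} (hk : 1 ≤ k) (v : Fin (2 * k + 1)) :
    (cycleBlock k v).card = 4 := by
  have hpair : ∀ a : ℕ, a < 2 * k + 1 →
      (Finset.univ.filter fun x : Fin (4 * k + 2) => x.val / 2 = a).card = 2 := by
    intro a ha
    have : (Finset.univ.filter fun x : Fin (4 * k + 2) => x.val / 2 = a) =
        {⟨2 * a, by omega⟩, ⟨2 * a + 1, by omega⟩} := by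
      ext x
      simp only [Finset.mem_filter, Finset.mem_univ, true_and, Finset.mem_insert,
        Finset.mem_singleton, Fin.ext_iff]
      omega
    rw [this, Finset.card_pair (by simp [Fin.ext_iff])]
  -- This is where `k ≥ 1` enters: in `Fin 1` the two pairs would coincide.
  have hne : v.val ≠ (v + 1).val := by
    intro h
    have : Fact (1 < 2 * k + 1) := ⟨by omega⟩
    have h1 : (1 : Fin (2 * k + 1)) = 0 := by
      simpa using (Fin.ext h : v = v + 1)
    have := congrArg Fin.val h1
    rw [Fin.val_one', Nat.mod_eq_of_lt (by omega)] at this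
    simp at this
  rw [cycleBlock, Finset.filter_or, Finset.card_union_of_disjoint, hpair _ v.isLt,
    hpair _ (v + 1).isLt]
  exact Finset.disjoint_filter.2 fun x _ h h' => hne (h.symm.trans h')

theorem card_cycleTriples {k : ℕ} (hk : 1 ≤ k) (v : Fin (2 * k + 1)) :
    (cycleTriples k v).card = 4 := by
  have h : (cycleTriples k v).map (Function.Embedding.subtype _) =
      Finset.powersetCard 3 (cycleBlock k v) := by
    ext s
    simp [cycleTriples, Finset.mem_powersetCard, and_comm]
  rw [← Finset.card_map (Function.Embedding.subtype _), h, Finset.card_powersetCard,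
    card_cycleBlock hk]
  rfl

theorem disjoint_cycleBlock {k : ℕ} (hk : 1 ≤ k) {v w : Fin (2 * k + 1)} (hne : v ≠ w)
    (hadj : ¬ (SimpleGraph.cycleGraph (2 * k + 1)).Adj v w) :
    Disjoint (cycleBlock k v) (cycleBlock k w) := by
  rw [cycleGraph_adj_iff (by omega), not_or] at hadj
  refine Finset.disjoint_left.2 fun x hx hx' => ?_
  simp only [cycleBlock, Finset.mem_filter, Finset.mem_univ, true_and] at hx hx'
  rcases hx with h | h <;> rcases hx' with h' | h' <;> have he := Fin.ext (h.symm.trans h')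
  · exact hne he
  · exact hadj.1 he
  · exact hadj.2 he.symm
  · exact hne (add_right_cancel he)

theorem cycleTriples_mem_assignments {k : ℕ} (hk : 1 ≤ k) :
    cycleTriples k ∈
      assignments (johnsonThree (4 * k + 2)) (SimpleGraph.cycleGraph (2 * k + 1)) := by
  have hsame : ∀ v, ∀ s ∈ cycleTriples k v, ∀ t ∈ cycleTriples k v,
      (s.1 ∩ t.1).card ≠ 1 := by
    intro v s hs t ht h
    simp only [cycleTriples, Finset.mem_filter, Finset.mem_univ, true_and] at hs ht
    -- Two triples inside four points meet in at least `3 + 3 - 4 = 2` points.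
    have hun := Finset.card_le_card (Finset.union_subset hs ht)
    have := Finset.card_union_add_card_inter s.1 t.1
    rw [card_cycleBlock hk] at hun
    have := s.2
    have := t.2
    omega
  refine ⟨fun v s hs t ht _ => hsame v s hs t ht, fun v w hne hadj => ?_⟩
  have hdisj : ∀ s ∈ cycleTriples k v, ∀ t ∈ cycleTriples k w, Disjoint s.1 t.1 := by
    intro s hs t ht
    simp only [cycleTriples, Finset.mem_filter, Finset.mem_univ, true_and] at hs ht
    exact (disjoint_cycleBlock hk hne hadj).mono hs ht
  have hcross : ∀ s ∈ cycleTriples k v, ∀ t ∈ cycleTriples k w, (s.1 ∩ t.1).card ≠ 1 := by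
    intro s hs t ht
    rw [Finset.disjoint_iff_inter_eq_empty.1 (hdisj s hs t ht)]
    simp
  refine ⟨Finset.disjoint_left.2 fun s hs hs' => ?_, ?_⟩
  · have h := (Finset.disjoint_self_iff_empty _).1 (hdisj s hs s hs')
    have := s.2
    rw [h] at this
    simp at this
  · rintro s (hs | hs) t (ht | ht) _
    · exact hsame v s hs t ht
    · exact hcross s hs t ht
    · exact fun h => hcross t ht s hs (SimpleGraph.Adj.symm h)
    · exact hsame w s hs t ht

theorem four_mul_shannonCapacity_cycleGraph_le {k : ℕ} (hk : 1 ≤ k) :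
    4 * shannonCapacity (SimpleGraph.cycleGraph (2 * k + 1)) ≤
      shannonCapacity (johnsonThree (4 * k + 2)) := by
  exact_mod_cast mul_shannonCapacity_le _ _ (pow_mul_indepNum_le_of_mem_assignments
    (cycleTriples_mem_assignments hk) fun v => (card_cycleTriples hk v).ge)

/-- A finite check over the 20 triples of six points. It bounds independent sets by `3 + 1` without
enumerating sets of triples. -/
theorem card_le_one_of_triples_six : ∀ a b c : {s : Finset (Fin 6) // s.card = 3},
    a ≠ b ∧ (a.1 ∩ b.1).card ≠ 1 → a ≠ c ∧ (a.1 ∩ c.1).card ≠ 1 →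
    b ≠ c ∧ (b.1 ∩ c.1).card ≠ 1 →
    (Finset.univ.filter fun d => (a ≠ d ∧ (a.1 ∩ d.1).card ≠ 1) ∧
      (b ≠ d ∧ (b.1 ∩ d.1).card ≠ 1) ∧ (c ≠ d ∧ (c.1 ∩ d.1).card ≠ 1)).card ≤ 1 := by
  decide +kernel

theorem card_le_four_of_isIndepSet_johnsonThree_six
    {T : Finset {s : Finset (Fin 6) // s.card = 3}} (hT : (johnsonThree 6).IsIndepSet T) :
    T.card ≤ 4 := by
  rcases Nat.lt_or_ge 2 T.card with h | h
  · obtain ⟨a, ha, b, hb, c, hc, hab, hac, hbc⟩ := Finset.two_lt_card.1 h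
    have hsub : T ⊆ {a, b, c} ∪ Finset.univ.filter fun d =>
        (a ≠ d ∧ (a.1 ∩ d.1).card ≠ 1) ∧ (b ≠ d ∧ (b.1 ∩ d.1).card ≠ 1) ∧
          (c ≠ d ∧ (c.1 ∩ d.1).card ≠ 1) := by
      intro d hd
      by_cases had : a = d
      · simp [had]
      by_cases hbd : b = d
      · simp [hbd]
      by_cases hcd : c = d
      · simp [hcd]
      exact Finset.mem_union_right _ (Finset.mem_filter.2 ⟨Finset.mem_univ d,
        ⟨had, hT ha hd had⟩, ⟨hbd, hT hb hd hbd⟩, ⟨hcd, hT hc hd hcd⟩⟩)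
    have h1 := card_le_one_of_triples_six a b c ⟨hab, hT ha hb hab⟩ ⟨hac, hT ha hc hac⟩
      ⟨hbc, hT hb hc hbc⟩
    have h2 := (Finset.card_le_card hsub).trans (Finset.card_union_le _ _)
    have h3 : ({a, b, c} : Finset _).card ≤ 3 := Finset.card_le_three
    omega
  · omega

end Johnson

/-! ### Verified independent sets in powers of short odd cycles -/

section Cycle

theorem cycleGraph_adj_iff_val {m : ℕ} (hm : 2 ≤ m) {u v : Fin m} :
    (SimpleGraph.cycleGraph m).Adj u v ↔ u.val = v.val + 1 ∨ v.val = u.val + 1 ∨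
      (u.val = 0 ∧ v.val + 1 = m) ∨ (v.val = 0 ∧ u.val + 1 = m) := by
  have : NeZero m := ⟨by omega⟩
  have hsucc : ∀ a b : Fin m, a = b + 1 ↔ a.val = b.val + 1 ∨ (a.val = 0 ∧ b.val + 1 = m) := by
    intro a b
    rw [Fin.ext_iff, Fin.val_add, Fin.val_one', Nat.add_mod_mod]
    rcases Nat.lt_or_ge (b.val + 1) m with h | h
    · rw [Nat.mod_eq_of_lt h]
      omega
    · have hb : b.val + 1 = m := by omega
      rw [hb, Nat.mod_self]
      omega
  rw [cycleGraph_adj_iff hm, hsucc, hsucc]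
  tauto

/-- The codes of the words over `Fin m` of length `d` that are equal or adjacent to the word with
base-`m` code `a` in every coordinate, as a bit mask. -/
def ballMask (m : ℕ) : ℕ → ℕ → ℕ
  | 0, _ => 1
  | d + 1, a =>
    ballMask m d a <<< (m ^ d * (a / m ^ d % m)) |||
      (ballMask m d a <<< (m ^ d * ((a / m ^ d % m + 1) % m)) |||
        ballMask m d a <<< (m ^ d * ((a / m ^ d % m + (m - 1)) % m)))

/-- Check that no word of the list lies in `F` or in the ball around an earlier word. -/
def avoidsBalls (m d : ℕ) : ℕ → List ℕ → Bool
  | _, [] => true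
  | F, a :: l => !F.testBit (a % m ^ d) && avoidsBalls m d (F ||| ballMask m d a) l

/-- Induction on the leading digit: the mask is three shifted copies of the shorter one, with `m -
1` playing the role of `-1`. Soundness of the check needs only that the mask contains the ball, not
equality. -/
theorem testBit_ballMask {m : ℕ} (d a b : ℕ)
    (h : ∀ i < d, b / m ^ i % m = a / m ^ i % m ∨ b / m ^ i % m = (a / m ^ i % m + 1) % m ∨
      b / m ^ i % m = (a / m ^ i % m + (m - 1)) % m) :
    (ballMask m d a).testBit (b % m ^ d) = true := by
  induction d with
  | zero => simp [ballMask, Nat.mod_one]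
  | succ d ih =>
    have hM := ih fun i hi => h i (by omega)
    have hshift : ∀ x, b / m ^ d % m = x →
        (ballMask m d a <<< (m ^ d * x)).testBit (b % m ^ (d + 1)) = true := by
      rintro x rfl
      rw [Nat.mod_pow_succ, Nat.testBit_shiftLeft, Nat.add_sub_cancel]
      simpa using hM
    rw [ballMask, Nat.testBit_or, Nat.testBit_or]
    rcases h d (by omega) with h' | h' | h' <;> simp only [hshift _ h', Bool.true_or, Bool.or_true]

theorem pairwise_of_avoidsBalls {m d : ℕ} (l : List ℕ) (F : ℕ) (h : avoidsBalls m d F l = true) :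
    (∀ b ∈ l, F.testBit (b % m ^ d) = false) ∧
      l.Pairwise fun a b => (ballMask m d a).testBit (b % m ^ d) = false := by
  induction l generalizing F with
  | nil => simp
  | cons a l ih =>
    rw [avoidsBalls, Bool.and_eq_true, Bool.not_eq_true'] at h
    obtain ⟨h1, h2⟩ := ih _ h.2
    simp only [Nat.testBit_or, Bool.or_eq_false_iff] at h1
    refine ⟨?_, List.pairwise_cons.2 ⟨fun b hb => (h1 b hb).2, h2⟩⟩
    rintro b hb
    rcases List.mem_cons.1 hb with rfl | hb
    · exact h.1
    · exact (h1 b hb).1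

/-- A list of codes that passes `avoidsBalls` is an independent set in a power of a cycle. -/
theorem length_le_indepNum_of_avoidsBalls {m : ℕ} (hm : 2 ≤ m) {d : ℕ} {l : List ℕ}
    (h : avoidsBalls m d 0 l = true) :
    l.length ≤ (strongPow (SimpleGraph.cycleGraph m) d).indepNum := by
  classical
  let w : ℕ → Fin d → Fin m := fun a i => ⟨a / m ^ i.val % m, Nat.mod_lt _ (by omega)⟩
  have hfar : l.Pairwise fun a b => ¬ ∀ i, w a i = w b i ∨
      (SimpleGraph.cycleGraph m).Adj (w a i) (w b i) := by
    refine (pairwise_of_avoidsBalls l 0 h).2.imp fun {a b} hab hclose => ?_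
    rw [testBit_ballMask] at hab
    · cases hab
    intro i hi
    have hlt := Nat.mod_lt (a / m ^ i) (show 0 < m by omega)
    have hlt' := Nat.mod_lt (b / m ^ i) (show 0 < m by omega)
    have hc := hclose ⟨i, hi⟩
    rw [cycleGraph_adj_iff_val hm, Fin.ext_iff] at hc
    simp only [w] at hc
    generalize a / m ^ i % m = x at *
    generalize b / m ^ i % m = y at *
    rcases hc with hc | hc | hc | ⟨hx, hy⟩ | ⟨hy, hx⟩
    · exact Or.inl hc.symm
    · refine Or.inr (Or.inr ?_)
      rw [show x + (m - 1) = y + m by omega, Nat.add_mod_right, Nat.mod_eq_of_lt hlt']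
    · refine Or.inr (Or.inl ?_)
      rw [← hc, Nat.mod_eq_of_lt hlt']
    · refine Or.inr (Or.inr ?_)
      rw [hx, zero_add, Nat.mod_eq_of_lt (by omega)]
      omega
    · refine Or.inr (Or.inl ?_)
      rw [hx, hy, Nat.mod_self]
  have hnodup : (l.map w).Nodup := by
    rw [List.Nodup, List.pairwise_map]
    exact hfar.imp fun hab he => hab fun i => Or.inl (by rw [he])
  have hpair : (l.map w).Pairwise fun x y => ¬ ∀ i, x i = y i ∨
      (SimpleGraph.cycleGraph m).Adj (x i) (y i) := List.pairwise_map.2 hfar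
  have hind : (strongPow (SimpleGraph.cycleGraph m) d).IsIndepSet ((l.map w).toFinset : Set _) := by
    intro x hx y hy hne hadj
    rw [Finset.mem_coe, List.mem_toFinset] at hx hy
    have : Std.Symm fun x y : Fin d → Fin m => ¬ ∀ i, x i = y i ∨
        (SimpleGraph.cycleGraph m).Adj (x i) (y i) :=
      ⟨fun x y hxy hc => hxy fun i => (hc i).imp Eq.symm SimpleGraph.Adj.symm⟩
    exact hpair.forall hx hy hne hadj.2
  simpa [List.toFinset_card_of_nodup hnodup] using hind.card_le_indepNum

/-- The entries are words of length 3 in base 9, and `4.32 ^ 3 < 81`. The other lists work likewise: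
`5.2895 ^ 3 < 148`, `6.2743 ^ 3 < 247`, `3.2578 ^ 5 < 367`. -/
theorem le_indepNum_cycleGraph_nine :
    81 ≤ (strongPow (SimpleGraph.cycleGraph 9) 3).indepNum :=
  length_le_indepNum_of_avoidsBalls (by norm_num) (l := [
    2, 9, 25, 32, 39, 46, 62, 69, 76, 87, 94, 101, 108, 124, 131, 138, 145, 161, 163, 179,
    186, 193, 200, 207, 223, 230, 237, 248, 255, 262, 278, 285, 292, 299, 306, 322, 324, 340,
    347, 354, 361, 377, 384, 391, 398, 409, 416, 423, 439, 446, 453, 460, 476, 483, 494, 501,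
    508, 515, 522, 538, 545, 552, 559, 570, 577, 593, 600, 607, 614, 621, 637, 644, 655, 662,
    669, 676, 692, 699, 706, 713, 720])
    (by decide +kernel)

theorem le_indepNum_cycleGraph_eleven :
    148 ≤ (strongPow (SimpleGraph.cycleGraph 11) 3).indepNum :=
  length_le_indepNum_of_avoidsBalls (by norm_num) (l := [
    6, 19, 32, 34, 36, 49, 62, 75, 84, 97, 99, 112, 114, 131, 133, 135, 148, 161, 174, 176,
    189, 198, 211, 213, 226, 239, 247, 260, 273, 275, 288, 290, 303, 312, 316, 325, 338, 351,
    353, 355, 372, 374, 387, 389, 402, 415, 428, 430, 450, 452, 454, 467, 480, 486, 488, 501,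
    514, 527, 529, 531, 544, 553, 557, 566, 579, 592, 594, 613, 626, 628, 630, 643, 656, 669,
    671, 691, 693, 706, 708, 721, 727, 729, 742, 755, 768, 770, 783, 785, 798, 805, 807, 820,
    833, 846, 854, 867, 869, 882, 884, 897, 910, 923, 932, 945, 947, 949, 962, 968, 981, 983,
    996, 1009, 1022, 1024, 1026, 1039, 1046, 1048, 1061, 1074, 1087, 1095, 1108, 1121, 1123,
    1125, 1138, 1151, 1164, 1173, 1186, 1188, 1201, 1203, 1220, 1222, 1224, 1238, 1251, 1264,
    1266, 1279, 1281, 1287, 1300, 1302, 1315, 1328])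
    (by decide +kernel)

theorem le_indepNum_cycleGraph_thirteen :
    247 ≤ (strongPow (SimpleGraph.cycleGraph 13) 3).indepNum :=
  length_le_indepNum_of_avoidsBalls (by norm_num) (l := [
    8, 13, 15, 35, 40, 42, 61, 68, 70, 88, 95, 97, 115, 121, 123, 141, 150, 157, 168, 173,
    175, 193, 200, 202, 219, 228, 235, 246, 255, 260, 262, 281, 286, 288, 308, 315, 317, 335,
    338, 340, 360, 364, 367, 386, 393, 395, 413, 420, 422, 439, 446, 448, 466, 475, 482, 493,
    502, 518, 525, 527, 544, 553, 560, 571, 580, 585, 587, 606, 611, 613, 633, 640, 642, 660,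
    667, 669, 685, 689, 691, 711, 718, 720, 738, 745, 747, 765, 771, 773, 791, 800, 807, 818,
    827, 832, 834, 849, 851, 869, 878, 885, 896, 905, 910, 912, 932, 936, 938, 958, 965, 967,
    985, 992, 994, 1012, 1014, 1016, 1036, 1043, 1045, 1063, 1070, 1072, 1090, 1096, 1099,
    1116, 1125, 1132, 1143, 1152, 1157, 1159, 1178, 1194, 1203, 1210, 1221, 1230, 1235, 1237,
    1257, 1261, 1263, 1283, 1290, 1292, 1310, 1317, 1319, 1337, 1343, 1345, 1361, 1368, 1370,
    1388, 1395, 1397, 1415, 1422, 1424, 1441, 1450, 1457, 1468, 1477, 1482, 1484, 1503, 1508,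
    1510, 1528, 1535, 1546, 1555, 1560, 1562, 1582, 1586, 1589, 1608, 1615, 1617, 1635, 1642,
    1644, 1662, 1668, 1670, 1688, 1693, 1695, 1713, 1720, 1722, 1740, 1747, 1749, 1766, 1775,
    1782, 1793, 1802, 1807, 1809, 1829, 1833, 1835, 1855, 1860, 1871, 1880, 1885, 1887, 1907,
    1912, 1914, 1933, 1940, 1942, 1960, 1967, 1969, 1987, 1994, 1996, 2013, 2022, 2038, 2045,
    2047, 2065, 2072, 2074, 2091, 2100, 2107, 2118, 2127, 2132, 2134, 2154, 2158, 2160, 2180,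
    2187, 2189])
    (by decide +kernel)

set_option maxRecDepth 4000 in
theorem le_indepNum_cycleGraph_seven :
    367 ≤ (strongPow (SimpleGraph.cycleGraph 7) 5).indepNum :=
  length_le_indepNum_of_avoidsBalls (by norm_num) (l := [
    22, 90, 101, 114, 175, 200, 274, 341, 350, 417, 442, 509, 541, 577, 608, 669, 734, 794,
    819, 918, 936, 1010, 1043, 1111, 1135, 1203, 1234, 1270, 1301, 1362, 1378, 1438, 1512,
    1530, 1611, 1629, 1703, 1755, 1779, 1847, 1871, 1907, 1939, 2006, 2030, 2082, 2107, 2174,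
    2248, 2273, 2347, 2365, 2410, 2446, 2477, 2538, 2562, 2637, 2661, 2729, 2787, 2805, 2879,
    2897, 2964, 2989, 3056, 3090, 3103, 3115, 3231, 3305, 3373, 3431, 3498, 3559, 3572, 3590,
    3658, 3682, 3749, 3808, 3826, 3900, 3967, 3999, 4066, 4077, 4090, 4142, 4167, 4203, 4234,
    4295, 4326, 4394, 4418, 4470, 4544, 4562, 4636, 4661, 4721, 4735, 4795, 4834, 4858, 4925,
    4950, 5024, 5049, 5116, 5175, 5242, 5253, 5266, 5327, 5352, 5426, 5444, 5527, 5551, 5619,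
    5643, 5742, 5760, 5778, 5868, 5886, 5946, 6020, 6045, 6119, 6137, 6195, 6263, 6287, 6355,
    6373, 6386, 6447, 6514, 6530, 6590, 6615, 6682, 6714, 6781, 6855, 6907, 6931, 6999, 7010,
    7023, 7091, 7109, 7183, 7221, 7295, 7313, 7387, 7412, 7472, 7486, 7497, 7549, 7562, 7623,
    7690, 7789, 7813, 7881, 7939, 7957, 8056, 8080, 8166, 8190, 8242, 8256, 8316, 8334, 8408,
    8433, 8507, 8574, 8583, 8650, 8675, 8711, 8742, 8810, 8834, 8902, 8960, 8978, 9052, 9070,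
    9151, 9169, 9229, 9243, 9295, 9319, 9355, 9386, 9447, 9478, 9546, 9570, 9683, 9750, 9842,
    9934, 9952, 9986, 10010, 10078, 10109, 10111, 10177, 10201, 10203, 10268, 10376, 10394,
    10486, 10580, 10627, 10679, 10704, 10755, 10771, 10795, 10847, 10870, 10894, 10955, 11020,
    11038, 11123, 11222, 11224, 11289, 11348, 11415, 11440, 11491, 11507, 11538, 11599, 11682,
    11743, 11767, 11866, 11868, 11933, 11958, 11960, 12005, 12072, 12146, 12171, 12232, 12245,
    12263, 12323, 12389, 12400, 12413, 12474, 12499, 12573, 12640, 12664, 12716, 12741, 12808,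
    12840, 12876, 12907, 12968, 12992, 13082, 13093, 13167, 13185, 13266, 13284, 13358, 13410,
    13434, 13502, 13526, 13562, 13600, 13661, 13685, 13737, 13811, 13829, 13903, 13928, 14002,
    14020, 14078, 14146, 14170, 14206, 14231, 14305, 14329, 14397, 14442, 14460, 14534, 14601,
    14619, 14693, 14711, 14776, 14837, 14861, 14929, 14960, 15028, 15052, 15088, 15104, 15178,
    15196, 15263, 15288, 15355, 15429, 15463, 15530, 15555, 15622, 15653, 15721, 15732, 15745,
    15797, 15858, 15871, 15889, 15950, 15981, 16048, 16073, 16125, 16199, 16266, 16291, 16365,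
    16376, 16389, 16450, 16466, 16502, 16533, 16594, 16618, 16693, 16717, 16784])
    (by decide +kernel)

end Cycle

/-! ### Asymptotics of the capacity of odd cycles -/

section Limit

theorem abs_sum_two_pow_mul_lt {d : ℕ} (δ : Fin d → ℤ) (hδ : ∀ i, |δ i| ≤ 1) :
    |∑ i, 2 ^ i.val * δ i| < 2 ^ d := by
  induction d with
  | zero => simp
  | succ d ih =>
    have h := ih (fun i => δ i.castSucc) fun i => hδ _
    rw [Fin.sum_univ_castSucc]
    have hl := hδ (Fin.last d)
    simp only [Fin.val_castSucc, Fin.val_last] at h ⊢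
    have h2 : |(2 : ℤ) ^ d * δ (Fin.last d)| ≤ 2 ^ d := by
      rw [abs_mul, abs_of_nonneg (by positivity : (0 : ℤ) ≤ 2 ^ d)]
      exact mul_le_of_le_one_right (by positivity) hl
    have := abs_add_le (∑ i : Fin d, (2 : ℤ) ^ i.val * δ i.castSucc) (2 ^ d * δ (Fin.last d))
    rw [pow_succ]
    linarith

/-- The lowest digit is even and at most 1 in absolute value, so it is 0; halve and repeat. -/
theorem eq_zero_of_sum_two_pow_mul_eq_zero {d : ℕ} (δ : Fin d → ℤ) (hδ : ∀ i, |δ i| ≤ 1)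
    (h : ∑ i, 2 ^ i.val * δ i = 0) : ∀ i, δ i = 0 := by
  induction d with
  | zero => exact fun i => i.elim0
  | succ d ih =>
    rw [Fin.sum_univ_succ] at h
    simp only [Fin.val_zero, pow_zero, one_mul, Fin.val_succ, pow_succ', mul_assoc,
      ← Finset.mul_sum] at h
    have h0 := abs_le.1 (hδ 0)
    refine Fin.cases (by omega) (ih (fun i => δ i.succ) (fun i => hδ _) (by omega))

theorem exists_abs_le_one_dvd_of_eq_or_adj {m : ℕ} (hm : 2 ≤ m) {u v : Fin m}
    (h : u = v ∨ (SimpleGraph.cycleGraph m).Adj u v) :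
    ∃ ε : ℤ, |ε| ≤ 1 ∧ (m : ℤ) ∣ (u.val : ℤ) - v.val - ε := by
  rw [cycleGraph_adj_iff_val hm] at h
  rcases h with rfl | h | h | ⟨h, h'⟩ | ⟨h, h'⟩
  · exact ⟨0, by simp, by simp⟩
  · exact ⟨1, by simp, 0, by omega⟩
  · exact ⟨-1, by simp, 0, by omega⟩
  · exact ⟨1, by simp, -1, by omega⟩
  · exact ⟨-1, by simp, 1, by omega⟩

/-- The words `(2 ^ (e + 1) * j + ∑ i, 2 ^ (i + 1) * y i, y)` over `ZMod (2 ^ (e + 1) * k + 1)`, with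
`j < k`, form an independent set. -/
theorem mul_pow_le_indepNum_cycleGraph (e : ℕ) {k : ℕ} (hk : 1 ≤ k) :
    k * (2 ^ (e + 1) * k + 1) ^ e ≤
      (strongPow (SimpleGraph.cycleGraph (2 ^ (e + 1) * k + 1)) (e + 1)).indepNum := by
  classical
  set m := 2 ^ (e + 1) * k + 1 with hm
  have hm2 : 2 ≤ m := by
    have : 0 < 2 ^ (e + 1) * k := by positivity
    omega
  let g : Fin k × (Fin e → Fin m) → Fin (e + 1) → Fin m := fun p =>
    Fin.cons ⟨(2 ^ (e + 1) * p.1.val + ∑ i, 2 ^ (i.val + 1) * (p.2 i).val) % m,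
      Nat.mod_lt _ (by omega)⟩ p.2
  have hg : ∀ p q, (∀ i, g p i = g q i ∨ (SimpleGraph.cycleGraph m).Adj (g p i) (g q i)) →
      p = q := by
    rintro ⟨j, y⟩ ⟨j', y'⟩ h
    choose ε hε hdvd using fun i => exists_abs_le_one_dvd_of_eq_or_adj hm2 (h i)
    -- Eliminating `y - y'` from the first coordinate leaves a congruence in `j - j'` and the
    -- coordinate errors; the first error enters with the opposite sign and weight 1.
    let δ : Fin (e + 1) → ℤ := Fin.cons (-ε 0) fun i => ε i.succ
    have hδ : ∀ i, |δ i| ≤ 1 := Fin.cases (by simpa [δ] using hε 0) fun i => by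
      simpa [δ] using hε i.succ
    have hy : ∀ i, (m : ℤ) ∣ ((y i).val : ℤ) - (y' i).val - ε i.succ := fun i => by
      simpa [g] using hdvd i.succ
    have hsum : ∑ i, 2 ^ i.val * δ i = -ε 0 + ∑ i : Fin e, 2 ^ (i.val + 1) * ε i.succ := by
      simp [δ, Fin.sum_univ_succ]
    have hT : (m : ℤ) ∣ 2 ^ (e + 1) * ((j.val : ℤ) - j'.val) + ∑ i, 2 ^ i.val * δ i := by
      have h0 := hdvd 0
      simp only [g, Fin.cons_zero, Nat.cast_add, Int.natCast_mod, Nat.cast_mul, Nat.cast_pow,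
        Nat.cast_ofNat, Nat.cast_sum] at h0
      have hmod : ∀ a : ℤ, (m : ℤ) ∣ a - a % m := fun a => Int.dvd_self_sub_emod
      have h1 := hmod (2 ^ (e + 1) * (j.val : ℤ) + ∑ i, 2 ^ (i.val + 1) * ((y i).val : ℤ))
      have h2 := hmod (2 ^ (e + 1) * (j'.val : ℤ) + ∑ i, 2 ^ (i.val + 1) * ((y' i).val : ℤ))
      have h3 : (m : ℤ) ∣ ∑ i : Fin e, 2 ^ (i.val + 1) *
          (((y i).val : ℤ) - (y' i).val - ε i.succ) :=
        Finset.dvd_sum fun i _ => (hy i).mul_left _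
      have h4 := (h0.add (h1.sub h2)).sub h3
      refine Eq.subst (motive := fun z : ℤ => (m : ℤ) ∣ z) ?_ h4
      rw [hsum]
      simp only [mul_sub, Finset.sum_sub_distrib]
      ring
    have hlt := abs_lt.1 (abs_sum_two_pow_mul_lt δ hδ)
    set s := ∑ i, 2 ^ i.val * δ i with hs
    have hj := j.isLt
    have hj' := j'.isLt
    have hpow : (0 : ℤ) < 2 ^ (e + 1) := by positivity
    have hmz : (m : ℤ) = 2 ^ (e + 1) * k + 1 := by rw [hm]; push_cast; ring
    -- The absolute value is below `2 ^ (e + 1) * (k - 1) + 2 ^ (e + 1) = m - 1`, so the congruence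
    -- is an equality of integers.
    have hzero : 2 ^ (e + 1) * ((j.val : ℤ) - j'.val) + s = 0 := by
      refine Int.eq_zero_of_abs_lt_dvd hT ?_
      rw [abs_lt, hmz]
      constructor <;> nlinarith
    have hjj : (j.val : ℤ) - j'.val = 0 := by
      by_contra hne
      rcases lt_or_gt_of_ne hne with h' | h' <;> nlinarith
    have hε0 := eq_zero_of_sum_two_pow_mul_eq_zero δ hδ (by rw [hjj] at hzero; simpa using hzero)
    have hyy : y = y' := by
      funext i
      have hi : ε i.succ = 0 := by simpa [δ] using hε0 i.succ
      have hd := hy i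
      rw [hi, sub_zero] at hd
      have := Int.eq_zero_of_abs_lt_dvd hd (by
        have := (y i).isLt
        have := (y' i).isLt
        rw [abs_lt]
        omega)
      exact Fin.ext (by omega)
    rw [hyy, Fin.ext (by omega : j.val = j'.val)]
  have hinj : Function.Injective g := fun p q h => hg p q fun i => Or.inl (by rw [h])
  have hind : (strongPow (SimpleGraph.cycleGraph m) (e + 1)).IsIndepSet
      ((Finset.univ.image g : Finset _) : Set (Fin (e + 1) → Fin m)) := by
    refine isIndepSet_strongPow fun x hx y hy hxy => ?_
    simp only [Finset.coe_image, Finset.coe_univ, Set.image_univ, Set.mem_range] at hx hy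
    obtain ⟨p, rfl⟩ := hx
    obtain ⟨q, rfl⟩ := hy
    rw [hg p q hxy]
  simpa [Finset.card_image_of_injective _ hinj] using hind.card_le_indepNum

/-- An odd cycle maps onto every shorter odd cycle. -/
theorem nonempty_hom_cycleGraph {p m : ℕ} (hp : 3 ≤ p) (hpm : p ≤ m) (hodd : Even (m - p)) :
    Nonempty (SimpleGraph.cycleGraph m →g SimpleGraph.cycleGraph p) := by
  -- The surplus vertices alternate on the edge `{p - 2, p - 1}`; as `m - p` is even, the last
  -- vertex lands on `p - 1`, next to 0.
  refine ⟨⟨fun x => ⟨if x.val < p then x.val else if (x.val - p) % 2 = 0 then p - 2 else p - 1,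
    by split_ifs <;> omega⟩, fun {u v} h => ?_⟩⟩
  rw [cycleGraph_adj_iff_val (by omega)] at h ⊢
  have hu := u.isLt
  have hv := v.isLt
  obtain ⟨r, hr⟩ := hodd
  simp only
  rcases h with h | h | ⟨h, h'⟩ | ⟨h, h'⟩ <;> split_ifs <;> omega

theorem pow_mul_indepNum_cycleGraph_le {p m : ℕ} (hp : 3 ≤ p) (hpm : p ≤ m)
    (hodd : Even (m - p)) (n : ℕ) :
    m ^ n * (strongPow (SimpleGraph.cycleGraph p) n).indepNum ≤
      p ^ n * (strongPow (SimpleGraph.cycleGraph m) n).indepNum := by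
  have : NeZero p := ⟨by omega⟩
  obtain ⟨φ⟩ := nonempty_hom_cycleGraph hp hpm hodd
  have h := card_pow_mul_indepNum_le_of_hom (A := Fin p) (fun a u v huv => by
    rw [cycleGraph_adj_iff (by omega)] at huv ⊢
    simpa [add_assoc] using huv) φ n
  simpa using h

/-- The Shannon capacity of a long odd cycle is close to half its length. -/
theorem le_shannonCapacity_cycleGraph (e n : ℕ) (hn : 2 ^ e ≤ n) :
    (2 * n + 1 : ℝ) / 2 - 2 / (e + 1) ≤
      -- Fold onto the longest cycle of length `p = 2 ^ (e + 1) * k + 1` that fits. This gives an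
      -- independent set of size at least `((2 * n + 1) / 2) ^ (e + 1) * (1 - 1 / p)`, and the root
      -- of the last factor costs little because `2 * n + 1 ≤ 2 * p`.
      shannonCapacity (SimpleGraph.cycleGraph (2 * n + 1)) := by
  set k := n / 2 ^ e with hk
  have hpos : 0 < 2 ^ e := by positivity
  have hk1 : 1 ≤ k := (Nat.one_le_div_iff hpos).2 hn
  have hkn : 2 ^ e * k ≤ n := Nat.mul_div_le n _
  have hnk : n < 2 ^ e * k + 2 ^ e := by
    have := Nat.lt_mul_div_succ n hpos
    rw [← hk, mul_add, mul_one] at this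
    exact this
  have hkk : 2 ^ e ≤ 2 ^ e * k := Nat.le_mul_of_pos_right _ hk1
  set p := 2 ^ (e + 1) * k + 1 with hp
  have hp' : p = 2 * (2 ^ e * k) + 1 := by rw [hp, pow_succ]; ring
  have hp3 : 3 ≤ p := by omega
  have hpm : p ≤ 2 * n + 1 := by omega
  have hm2 : 2 * n + 1 ≤ 2 * p := by omega
  have hlat := mul_pow_le_indepNum_cycleGraph e hk1
  have hhom := pow_mul_indepNum_cycleGraph_le hp3 hpm
    ⟨n - 2 ^ e * k, by omega⟩ (e + 1)
  rw [← hp] at hlat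
  set α := (strongPow (SimpleGraph.cycleGraph (2 * n + 1)) (e + 1)).indepNum
  have hcount : (2 * n + 1) ^ (e + 1) * k ≤ p * α := by
    have h := (Nat.mul_le_mul_left ((2 * n + 1) ^ (e + 1)) hlat).trans hhom
    rw [← mul_assoc, mul_comm _ (p ^ e), pow_succ p, mul_assoc] at h
    exact Nat.le_of_mul_le_mul_left h (by positivity)
  have hcountR : ((2 * n + 1 : ℝ)) ^ (e + 1) * k ≤ p * α := by exact_mod_cast hcount
  have hpR : (3 : ℝ) ≤ p := by exact_mod_cast hp3
  have hpk : (p : ℝ) - 1 = 2 ^ (e + 1) * k := by rw [hp]; push_cast; ring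
  have hm2R : (2 * n + 1 : ℝ) ≤ 2 * p := by exact_mod_cast hm2
  have he : (0 : ℝ) < e + 1 := by positivity
  let u : ℝ := 1 / p
  have hu0 : 0 < u := by positivity
  have hu : u ≤ 1 / 3 := one_div_le_one_div_of_le (by norm_num) hpR
  have hpu : (p : ℝ) * u = 1 := by simp only [u]; field_simp
  -- Bernoulli's inequality points the other way, hence the doubled `u`: the power is at most `exp
  -- (-2u) ≤ 1 / (1 + 2u) ≤ 1 - u`, the last step because `u ≤ 1 / 2`.
  have hbern : (1 - 2 * u / (e + 1)) ^ (e + 1) ≤ 1 - u := by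
    have h1 := Real.one_sub_div_pow_le_exp_neg (n := e + 1) (t := 2 * u) (by push_cast; linarith)
    push_cast at h1
    refine h1.trans ?_
    rw [Real.exp_neg, inv_le_comm₀ (Real.exp_pos _) (by linarith)]
    refine le_trans ?_ (Real.add_one_le_exp (2 * u))
    rw [inv_le_iff_one_le_mul₀ (by linarith)]
    nlinarith
  have hfac : 0 ≤ 1 - 2 * u / (e + 1) := by
    rw [sub_nonneg, div_le_one he]
    linarith
  have hy : (2 * n + 1 : ℝ) / 2 * (1 - 2 * u / (e + 1)) ≤
      shannonCapacity (SimpleGraph.cycleGraph (2 * n + 1)) := by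
    refine le_shannonCapacity_of_pow_le _ (d := e + 1) (by omega) (by positivity) ?_
    rw [mul_pow, div_pow]
    refine (mul_le_mul_of_nonneg_left hbern (by positivity)).trans ?_
    have h1 : (1 - u) = 2 ^ (e + 1) * k / p := by
      rw [← hpk]
      simp only [u]
      field_simp
    rw [h1, div_mul_div_comm, div_le_iff₀ (by positivity)]
    calc (2 * n + 1 : ℝ) ^ (e + 1) * (2 ^ (e + 1) * k)
        = 2 ^ (e + 1) * ((2 * n + 1 : ℝ) ^ (e + 1) * k) := by ring
      _ ≤ 2 ^ (e + 1) * (p * α) := mul_le_mul_of_nonneg_left hcountR (by positivity)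
      _ = α * (2 ^ (e + 1) * p) := by ring
  refine le_trans ?_ hy
  have h2 : (2 * n + 1 : ℝ) / 2 * (2 * u / (e + 1)) ≤ 2 / (e + 1) := by
    rw [← mul_div_assoc]
    refine div_le_div_of_nonneg_right ?_ he.le
    nlinarith
  linarith

theorem tendsto_sub_shannonCapacity_johnsonThree :
    Tendsto (fun n : ℕ => (4 * (n : ℝ) + 2) - shannonCapacity (johnsonThree (4 * n + 2)))
      atTop (𝓝 0) := by
  rw [Metric.tendsto_atTop]
  intro ε hε
  obtain ⟨e, he⟩ := exists_nat_gt (8 / ε)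
  refine ⟨2 ^ e, fun n hn => ?_⟩
  have hn1 : 1 ≤ n := Nat.one_le_two_pow.trans hn
  have hupper : shannonCapacity (johnsonThree (4 * n + 2)) ≤ 4 * (n : ℝ) + 2 := by
    exact_mod_cast shannonCapacity_le_of_le_pow _ (indepNum_strongPow_johnsonThree_le (4 * n + 2))
  have hlower := (mul_le_mul_of_nonneg_left (le_shannonCapacity_cycleGraph e n hn)
    (by norm_num : (0 : ℝ) ≤ 4)).trans (four_mul_shannonCapacity_cycleGraph_le hn1)
  have hsmall : 8 / ((e : ℝ) + 1) < ε := by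
    rw [div_lt_iff₀ hε] at he
    rw [div_lt_iff₀ (by positivity)]
    nlinarith
  have h8 : 4 * (2 / ((e : ℝ) + 1)) = 8 / (e + 1) := by ring
  rw [Real.dist_eq, sub_zero, abs_of_nonneg (by linarith)]
  linarith

end Limit

/-! ### Optimality of four triples per vertex, and numerical consequences -/

section Bounds

theorem exists_card_le_four_of_mem_assignments {k : ℕ} (hk : 1 ≤ k)
    {f : Fin (2 * k + 1) → Finset {s : Finset (Fin (4 * k + 2)) // s.card = 3}}
    (hf : f ∈ assignments (johnsonThree (4 * k + 2)) (SimpleGraph.cycleGraph (2 * k + 1))) :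
    ∃ v, (f v).card ≤ 4 := by
  by_contra! h
  have hpow : ∀ n, 5 ^ n * (strongPow (SimpleGraph.cycleGraph (2 * k + 1)) n).indepNum ≤
      (4 * k + 2) ^ n := fun n =>
    (pow_mul_indepNum_le_of_mem_assignments hf h n).trans (indepNum_strongPow_johnsonThree_le _ n)
  -- For `k ≥ 3` the first power already fails, `5k > 4k + 2`. For `k = 2` the pentagon's square
  -- gives `25 * 5 > 10 ^ 2`. For the triangle the inequality is only `5 ^ n ≤ 6 ^ n`, so six points
  -- need a direct argument.
  rcases (by omega : k = 1 ∨ k = 2 ∨ 3 ≤ k) with rfl | rfl | hk3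
  · have := card_le_four_of_isIndepSet_johnsonThree_six (hf.1 0)
    have := h 0
    omega
  · have h1 : 5 ≤ (strongPow (SimpleGraph.cycleGraph (2 * 2 + 1)) 2).indepNum :=
      mul_pow_le_indepNum_cycleGraph 1 (k := 1) le_rfl
    have h2 := hpow 2
    omega
  · have h1 : k * 1 ≤ (strongPow (SimpleGraph.cycleGraph (2 * k + 1)) 1).indepNum :=
      mul_pow_le_indepNum_cycleGraph 0 hk
    have h2 := hpow 1
    rw [pow_one, pow_one] at h2
    omega

theorem gammaZero_cycleGraph_johnsonThree {k : ℕ} (hk : 1 ≤ k) :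
    gammaZero (SimpleGraph.cycleGraph (2 * k + 1)) (johnsonThree (4 * k + 2)) = 1 / 4 := by
  refine le_antisymm ?_ (le_iInf₂ fun f hf => ?_)
  · refine (iInf₂_le _ (cycleTriples_mem_assignments hk)).trans (iSup_le fun v => ?_)
    rw [card_cycleTriples hk]
    norm_num
  · obtain ⟨v, hv⟩ := exists_card_le_four_of_mem_assignments hk hf
    refine le_trans ?_ (le_iSup _ v)
    exact ENNReal.div_le_div_left (by exact_mod_cast hv) 1

/-- A large independent set in a power of a cycle gives a lower bound for the capacity of
the triple graph. -/
theorem four_mul_le_shannonCapacity_johnsonThree {k d : ℕ} (hk : 1 ≤ k) (hd : 0 < d) {y : ℝ}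
    (hy : 0 ≤ y) {a : ℕ} (ha : a ≤ (strongPow (SimpleGraph.cycleGraph (2 * k + 1)) d).indepNum)
    (hya : y ^ d ≤ a) : 4 * y ≤ shannonCapacity (johnsonThree (4 * k + 2)) := by
  have h := le_shannonCapacity_of_pow_le _ hd hy (hya.trans (Nat.cast_le.2 ha))
  linarith [four_mul_shannonCapacity_cycleGraph_le hk]

/-- The Haemers number is an integer between the capacity and `n`. The four numerical bounds
narrowly suffice; for instance `4 * 3.2578 > 13`. -/
theorem haemersNumber_johnsonThree_eq {n : ℕ} {y : ℝ} (hy : y ≤ shannonCapacity (johnsonThree n))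
    (hn : (n : ℝ) - 1 < y) : haemersNumber (johnsonThree n) = n := by
  refine le_antisymm (haemersNumber_johnsonThree_le n) ?_
  have h : (n : ℝ) < haemersNumber (johnsonThree n) + 1 := by
    linarith [shannonCapacity_le_haemersNumber (johnsonThree n)]
  exact Nat.lt_succ_iff.1 (by exact_mod_cast h)

end Bounds

theorem mainTheorem6 :
    (∀ k : ℕ, 1 ≤ k →
      gammaZero (SimpleGraph.cycleGraph (2 * k + 1)) (johnsonThree (4 * k + 2)) = 1 / 4 ∧
      4 * shannonCapacity (SimpleGraph.cycleGraph (2 * k + 1)) ≤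
        shannonCapacity (johnsonThree (4 * k + 2)) ∧
      shannonCapacity (johnsonThree (4 * k + 2)) ≤
        (haemersNumber (johnsonThree (4 * k + 2)) : ℝ) ∧
      ⌈4 * shannonCapacity (SimpleGraph.cycleGraph (2 * k + 1))⌉ ≤
        (haemersNumber (johnsonThree (4 * k + 2)) : ℤ)) ∧
    4 * 3.2578 ≤ shannonCapacity (johnsonThree 14) ∧
    4 * 4.32 ≤ shannonCapacity (johnsonThree 18) ∧
    4 * 5.2895 ≤ shannonCapacity (johnsonThree 22) ∧
    4 * 6.2743 ≤ shannonCapacity (johnsonThree 26) ∧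
    (∀ n : ℕ, n = 14 ∨ n = 18 ∨ n = 22 ∨ n = 26 → haemersNumber (johnsonThree n) = n) ∧
    Tendsto (fun n : ℕ => (4 * (n : ℝ) + 2) - shannonCapacity (johnsonThree (4 * n + 2)))
      atTop (𝓝 0) := by
  have h14 : 4 * 3.2578 ≤ shannonCapacity (johnsonThree 14) :=
    four_mul_le_shannonCapacity_johnsonThree (k := 3) (by norm_num) (by norm_num) (by norm_num)
      le_indepNum_cycleGraph_seven (by norm_num)
  have h18 : 4 * 4.32 ≤ shannonCapacity (johnsonThree 18) :=
    four_mul_le_shannonCapacity_johnsonThree (k := 4) (by norm_num) (by norm_num) (by norm_num)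
      le_indepNum_cycleGraph_nine (by norm_num)
  have h22 : 4 * 5.2895 ≤ shannonCapacity (johnsonThree 22) :=
    four_mul_le_shannonCapacity_johnsonThree (k := 5) (by norm_num) (by norm_num) (by norm_num)
      le_indepNum_cycleGraph_eleven (by norm_num)
  have h26 : 4 * 6.2743 ≤ shannonCapacity (johnsonThree 26) :=
    four_mul_le_shannonCapacity_johnsonThree (k := 6) (by norm_num) (by norm_num) (by norm_num)
      le_indepNum_cycleGraph_thirteen (by norm_num)
  refine ⟨fun k hk => ⟨gammaZero_cycleGraph_johnsonThree hk,
    four_mul_shannonCapacity_cycleGraph_le hk, shannonCapacity_le_haemersNumber _, ?_⟩,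
    h14, h18, h22, h26, ?_, tendsto_sub_shannonCapacity_johnsonThree⟩
  · rw [Int.ceil_le]
    exact_mod_cast (four_mul_shannonCapacity_cycleGraph_le hk).trans
      (shannonCapacity_le_haemersNumber _)
  · rintro n (rfl | rfl | rfl | rfl)
    · exact haemersNumber_johnsonThree_eq h14 (by norm_num)
    · exact haemersNumber_johnsonThree_eq h18 (by norm_num)
    · exact haemersNumber_johnsonThree_eq h22 (by norm_num)
    · exact haemersNumber_johnsonThree_eq h26 (by norm_num)
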